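/- Let $p(m)$ denote the number of partitions of the integer $m$, with $p(0)=1$ and $p(m)=0$ for $m<0$. For a partition $\lambda$ and an integer $r\ge 1$, let $g_r(\lambda)$ (the least $r$-gap of $\lambda$) be the smallest positive integer that appears fewer than $r$ times as a part of $\lambda$. Let $S_2(n)=\sum_{\lambda\vdash n} g_2(\lambda)$, let $G_2(n)$ be the number of partitions $\lambda$ of $n$ with $g_2(\lambda)<g_1(\lambda)$, and let $p_e(n)$ be the number of partitions of $n$ into an even number of parts (the empty partition of $0$ has $0$ parts, so it is counted). Then for every integer $n\ge 0$: (i) $\displaystyle \sum_{k=0}^\infty p\left(n-(2k)^2\right)=\frac{S_2(n)+G_2(n)+p_e(n)}{2}$; (ii) $\displaystyle \sum_{k=0}^\infty p\left(n-(2k+1)^2\right)=\frac{S_2(n)+G_2(n)-p_e(n)}{2}$. -/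

import Mathlib

namespace LeastGap

/-- Euler's partition function on the integers: the number of partitions of `m`,
with `p m = 0` for negative `m`. -/
def p (m : ℤ) : ℕ :=
  if 0 ≤ m then Fintype.card (Nat.Partition m.toNat) else 0

/-- The least `r`-gap of a partition: the smallest positive integer that appears
fewer than `r` times as a part. For `r = 0` there is no such integer and the value is `⊤`,
which is the usual convention. -/
noncomputable def gap (r : ℕ) {n : ℕ} (l : Nat.Partition n) : ℕ∞ :=
  ⨅ i ∈ {i : ℕ | 0 < i ∧ l.parts.count i < r}, (i : ℕ∞)

/-- For `r ≥ 1` the least `r`-gap is a natural number, so that `ENat.toNat` loses nothing. -/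
theorem gap_ne_top {r : ℕ} (hr : 1 ≤ r) {n : ℕ} (l : Nat.Partition n) : gap r l ≠ ⊤ := by
  have hmem : n + 1 ∈ {i : ℕ | 0 < i ∧ l.parts.count i < r} := by
    refine ⟨Nat.succ_pos n, ?_⟩
    have h0 : l.parts.count (n + 1) = 0 := by
      rw [Multiset.count_eq_zero]
      intro h
      have h1 := Multiset.single_le_sum (fun x _ => Nat.zero_le x) _ h
      rw [l.parts_sum] at h1
      omega
    omega
  have hle : gap r l ≤ ((n + 1 : ℕ) : ℕ∞) := biInf_le (fun i : ℕ => (i : ℕ∞)) hmem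
  exact ne_top_of_le_ne_top (ENat.natCast_ne_top _) hle

/-- The sum of the least `r`-gaps over all partitions of `n` (for `r ≥ 1`). -/
noncomputable def S (r n : ℕ) : ℕ :=
  ∑ l : Nat.Partition n, (gap r l).toNat

/-- The number of partitions of `n` whose least `r`-gap is strictly smaller than their
least `(r - 1)`-gap (for `r ≥ 1`). -/
noncomputable def G (r n : ℕ) : ℕ :=
  Nat.card {l : Nat.Partition n // gap r l < gap (r - 1) l}

/-- The number of partitions of `n` into an even number of parts. -/
noncomputable def pEven (n : ℕ) : ℕ :=
  Nat.card {l : Nat.Partition n // Even (Multiset.card l.parts)}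

end LeastGap

/-! Both identities follow by adding and subtracting two evaluations. First, `∑ p(n - k²) = S₂ + G₂`
counts pairs `(λ, k)` where `λ` contains `1, 1, …, k-1, k-1, k`, a multiset of sum `k²`
(`S_add_G_eq_sum`). Second, `∑ (-1)^k p(n - k²) = p_e` comes from Gauss's identity `∏ (1 - x^i) = ∏
(1 + x^i) · (1 + 2 ∑_{k ≥ 1} (-1)^k x^(k²))`: dividing by both products puts on one side the series
of partitions signed by number of parts, whose coefficients are `2 p_e(n) - p(n)`. -/

namespace LeastGap

/-! ### Finite form of Gauss's identity -/

section Gauss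

variable {R : Type*} [CommRing R]

/-- The numerator of the error term in the finite form of Gauss's identity. -/
def gaussSum (x : R) (n : ℕ) : R :=
  ∑ s ∈ Finset.range (n + 1), (-1) ^ s * x ^ (s * (n + 1)) *
    (∏ i ∈ Finset.range s, (1 + x ^ i)) * ∏ i ∈ Finset.Ico s n, (1 - x ^ (i + 1))

theorem gaussSum_succ (x : R) (n : ℕ) :
    gaussSum x (n + 1) - (1 + x ^ (n + 1)) * gaussSum x n =
      (-1) ^ (n + 1) * x ^ ((n + 1) ^ 2) * ∏ i ∈ Finset.range (n + 2), (1 + x ^ i) := by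
  have telescope : ∑ s ∈ Finset.range (n + 1),
      ((-1) ^ s * x ^ (s * (n + 1 + 1)) * (∏ i ∈ Finset.range s, (1 + x ^ i)) *
          ∏ i ∈ Finset.Ico s (n + 1), (1 - x ^ (i + 1)) -
        (1 + x ^ (n + 1)) * ((-1) ^ s * x ^ (s * (n + 1)) *
          (∏ i ∈ Finset.range s, (1 + x ^ i)) * ∏ i ∈ Finset.Ico s n, (1 - x ^ (i + 1)))) =
      ∑ s ∈ Finset.range (n + 1),
        (((-1) ^ (s + 1) * x ^ ((s + 1) * (n + 1)) * (∏ i ∈ Finset.range (s + 1), (1 + x ^ i)) *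
            ∏ i ∈ Finset.Ico (s + 1) (n + 1), (1 - x ^ i)) -
          ((-1) ^ s * x ^ (s * (n + 1)) * (∏ i ∈ Finset.range s, (1 + x ^ i)) *
            ∏ i ∈ Finset.Ico s (n + 1), (1 - x ^ i))) := by
    refine Finset.sum_congr rfl fun s hs => ?_
    have hsn : s ≤ n := Nat.lt_succ_iff.mp (Finset.mem_range.mp hs)
    have hshift : ∏ i ∈ Finset.Ico (s + 1) (n + 1), (1 - x ^ i) =
        ∏ i ∈ Finset.Ico s n, (1 - x ^ (i + 1)) := by
      rw [Finset.prod_Ico_add' (fun i => 1 - x ^ i)]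
    rw [Finset.prod_Ico_succ_top hsn,
      Finset.prod_eq_prod_Ico_succ_bot (Nat.lt_succ_of_le hsn) (fun i => 1 - x ^ i),
      hshift, Finset.prod_range_succ]
    ring
  rw [gaussSum, gaussSum, Finset.sum_range_succ _ (n + 1), Finset.mul_sum, add_sub_right_comm,
    ← Finset.sum_sub_distrib, telescope,
    Finset.sum_range_sub fun s => (-1) ^ s * x ^ (s * (n + 1)) *
      (∏ i ∈ Finset.range s, (1 + x ^ i)) * ∏ i ∈ Finset.Ico s (n + 1), (1 - x ^ i),
    Finset.prod_range_succ _ (n + 1)]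
  -- The lower boundary term of the telescoping sum vanishes through its factor `1 - x ^ 0`.
  have hzero : ∏ i ∈ Finset.Ico 0 (n + 1), (1 - x ^ i) = 0 :=
    Finset.prod_eq_zero (i := 0) (by simp) (by simp)
  rw [hzero]
  simp only [Finset.Ico_self, Finset.prod_empty]
  ring

/-- Shanks's finite form of Gauss's identity. -/
theorem gaussSum_eq (x : R) (n : ℕ) :
    gaussSum x n = (∏ i ∈ Finset.range n, (1 + x ^ (i + 1))) *
      ∑ k ∈ Finset.range (n + 1), (if k = 0 then 1 else 2 * (-1) ^ k) * x ^ (k ^ 2) := by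
  induction n with
  | zero => simp [gaussSum]
  | succ n ih =>
    have h := gaussSum_succ x n
    -- The split-off factor `1 + x ^ 0` is the coefficient 2 of the theta series.
    rw [Finset.prod_range_succ' _ (n + 1)] at h
    rw [Finset.sum_range_succ _ (n + 1), if_neg n.succ_ne_zero, mul_add]
    rw [sub_eq_iff_eq_add.mp h, ih, Finset.prod_range_succ]
    ring

/-- The term `s = 0` is the Euler product; every other term carries `x ^ (s * (n + 1))`. -/
theorem pow_dvd_gaussSum_sub (x : R) (n : ℕ) :
    x ^ (n + 1) ∣ gaussSum x n - ∏ i ∈ Finset.range n, (1 - x ^ (i + 1)) := by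
  rw [gaussSum, Finset.sum_range_succ']
  simp only [pow_zero, zero_mul, one_mul, Finset.range_zero, Finset.prod_empty,
    ← Finset.range_eq_Ico, add_sub_cancel_right]
  refine Finset.dvd_sum fun s _ => ?_
  refine Dvd.dvd.mul_right (Dvd.dvd.mul_right (Dvd.dvd.mul_left (pow_dvd_pow x ?_) _) _) _
  nlinarith

end Gauss

/-! ### Generating functions and the alternating sum -/

open PowerSeries Filter Topology
open scoped PowerSeries.WithPiTopology

/-- The generating function of partitions weighted by `a ^ (number of parts)`. -/
noncomputable def lengthGenFun (a : ℚ) : ℚ⟦X⟧ :=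
  Nat.Partition.genFun fun _ c => a ^ c

theorem coeff_lengthGenFun (a : ℚ) (n : ℕ) :
    coeff n (lengthGenFun a) = ∑ l : Nat.Partition n, a ^ Multiset.card l.parts := by
  rw [lengthGenFun, Nat.Partition.coeff_genFun]
  refine Finset.sum_congr rfl fun l _ => ?_
  rw [Finsupp.prod, Finset.prod_pow_eq_pow_sum]
  simp

/-- Each factor of the generating function is the geometric series inverse to `1 - a X^(i+1)`. The
values `a = 1` and `a = -1` give the two products in Gauss's identity. -/
theorem exists_tendsto_lengthGenFun_mul (a : ℚ) :
    ∃ D : ℚ⟦X⟧, Tendsto (fun n => ∏ i ∈ Finset.range n, (1 - C a * X ^ (i + 1))) atTop (𝓝 D) ∧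
      lengthGenFun a * D = 1 := by
  have hmul : Multipliable fun i : ℕ => (1 : ℚ⟦X⟧) - C a * X ^ (i + 1) := by
    simp_rw [sub_eq_add_neg]
    apply WithPiTopology.multipliable_one_add_of_tendsto_order_atTop_nhds_top
    refine ENat.tendsto_nhds_top_iff_natCast_lt.mpr fun n => eventually_atTop.mpr ⟨n, ?_⟩
    intro m hm
    rw [order_neg]
    grw [← le_order_mul]
    refine lt_add_of_nonneg_of_lt (by simp) ?_
    rw [order_X_pow]
    norm_cast
    omega
  obtain ⟨D, hD⟩ := hmul
  refine ⟨D, hD.tendsto_prod_nat, ?_⟩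
  have h := (Nat.Partition.hasProd_genFun fun _ c => a ^ c).mul hD
  refine h.unique ?_
  convert! hasProd_one using 2 with i
  have hc : constantCoeff (C a * X ^ (i + 1) : ℚ⟦X⟧) = 0 := by simp
  have hs := WithPiTopology.summable_pow_of_constantCoeff_eq_zero hc
  have h1 := WithPiTopology.tsum_pow_mul_one_sub_of_constantCoeff_eq_zero hc
  rw [hs.tsum_eq_zero_add, pow_zero] at h1
  convert! h1 using 5 with j
  rw [mul_pow, ← pow_mul, smul_eq_C_mul, map_pow]

/-- Gauss's identity, divided by the Euler product. -/
theorem hasSum_lengthGenFun_one_mul :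
    HasSum (fun k : ℕ => lengthGenFun 1 * ((if k = 0 then 1 else 2 * (-1) ^ k) * X ^ (k ^ 2)))
      (lengthGenFun (-1)) := by
  obtain ⟨N, hN, hPN⟩ := exists_tendsto_lengthGenFun_mul 1
  obtain ⟨D, hD, hAD⟩ := exists_tendsto_lengthGenFun_mul (-1)
  have hsum : Summable fun k : ℕ => ((if k = 0 then 1 else 2 * (-1) ^ k) * X ^ (k ^ 2) : ℚ⟦X⟧) := by
    apply WithPiTopology.summable_of_tendsto_order_atTop_nhds_top
    refine ENat.tendsto_nhds_top_iff_natCast_lt.mpr fun n => eventually_atTop.mpr ⟨n + 1, ?_⟩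
    intro m hm
    grw [← le_order_mul]
    refine lt_add_of_nonneg_of_lt (by simp) ?_
    rw [order_X_pow]
    norm_cast
    nlinarith
  obtain ⟨T, hT⟩ := hsum
  have herr : Tendsto (fun n => gaussSum (X : ℚ⟦X⟧) n -
      ∏ i ∈ Finset.range n, (1 - X ^ (i + 1))) atTop (𝓝 0) := by
    rw [WithPiTopology.tendsto_iff_coeff_tendsto]
    intro d
    refine tendsto_atTop_of_eventually_const (i₀ := d) fun n hn => ?_
    rw [map_zero]
    exact X_pow_dvd_iff.mp (pow_dvd_gaussSum_sub X n) d (by omega)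
  have hDT : D * T = N := by
    refine tendsto_nhds_unique
      (hD.mul (hT.tendsto_sum_nat.comp (tendsto_add_atTop_nat 1))) ?_
    convert herr.add hN using 2 with n
    · rw [gaussSum_eq]
      simp
    · rw [zero_add]
  have h := hT.mul_left (lengthGenFun 1)
  have hPT : lengthGenFun 1 * T = lengthGenFun (-1) := by
    -- With `P`, `A` the series for `1`, `-1`: `P T = P T (A D) = P A N = A`.
    linear_combination (-(lengthGenFun 1 * T)) * hAD + lengthGenFun (-1) * hPN +
      lengthGenFun 1 * lengthGenFun (-1) * hDT
  rwa [hPT] at h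

theorem coeff_lengthGenFun_one_mul_X_pow (n m : ℕ) :
    coeff n (lengthGenFun 1 * X ^ m) = (p ((n : ℤ) - m) : ℚ) := by
  rw [coeff_mul_X_pow', p]
  by_cases h : m ≤ n
  · rw [if_pos h, if_pos (by omega), coeff_lengthGenFun, ← Nat.cast_sub h, Int.toNat_natCast]
    simp
  · rw [if_neg h, if_neg (by omega), Nat.cast_zero]

theorem sum_neg_one_pow_card (n : ℕ) :
    ∑ l : Nat.Partition n, (-1 : ℚ) ^ Multiset.card l.parts = 2 * pEven n - p n := by
  have h : ∀ l : Nat.Partition n, (-1 : ℚ) ^ Multiset.card l.parts =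
      2 * (if Even (Multiset.card l.parts) then 1 else 0) - 1 := by
    intro l
    split_ifs with hl
    · rw [hl.neg_one_pow]; norm_num
    · rw [(Nat.not_even_iff_odd.mp hl).neg_one_pow]; norm_num
  rw [Finset.sum_congr rfl fun l _ => h l, Finset.sum_sub_distrib, ← Finset.mul_sum,
    Finset.sum_boole, pEven, Nat.card_eq_fintype_card, Fintype.card_subtype, p,
    if_pos (by omega), Int.toNat_natCast]
  simp

/-- The number of partitions into an even number of parts as an alternating sum over squares. -/
theorem hasSum_neg_one_pow_mul_p (n : ℕ) :
    HasSum (fun k : ℕ => (-1 : ℚ) ^ k * p ((n : ℤ) - (k : ℤ) ^ 2)) (pEven n) := by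
  have h := (WithPiTopology.hasSum_iff_hasSum_coeff ℚ).mp hasSum_lengthGenFun_one_mul n
  rw [coeff_lengthGenFun, sum_neg_one_pow_card] at h
  -- Adding `p n` at `k = 0` raises the coefficient there from 1 to 2 and cancels `- p n`, so
  -- everything can be halved.
  have h2 := ((h.add (hasSum_ite_eq 0 (p n : ℚ))).div_const 2)
  convert! h2 using 1
  · funext k
    have hk : coeff n (lengthGenFun 1 * ((if k = 0 then 1 else 2 * (-1) ^ k) * X ^ (k ^ 2))) =
        (if k = 0 then 1 else 2 * (-1) ^ k) * (p ((n : ℤ) - (k : ℤ) ^ 2) : ℚ) := by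
      have hC : (if k = 0 then 1 else 2 * (-1) ^ k : ℚ⟦X⟧) =
          C (if k = 0 then 1 else 2 * (-1) ^ k : ℚ) := by
        split_ifs
        · rw [map_one]
        · rw [map_mul, map_pow, map_neg, map_one, map_ofNat]
      rw [hC, mul_left_comm, coeff_C_mul, coeff_lengthGenFun_one_mul_X_pow]
      push_cast
      rfl
    rw [hk]
    rcases eq_or_ne k 0 with rfl | hk0
    · simp
    · simp only [if_neg hk0]
      ring
  · ring

/-! ### Counting partitions that contain a staircase -/

theorem lt_toNat_gap_iff {r : ℕ} (hr : 1 ≤ r) {n : ℕ} (l : Nat.Partition n) (k : ℕ) :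
    k < (gap r l).toNat ↔ ∀ i, 0 < i → i ≤ k → r ≤ l.parts.count i := by
  have hcoe : ((gap r l).toNat : ℕ∞) = gap r l := ENat.natCast_toNat (gap_ne_top hr l)
  rw [← Nat.succ_le_iff, ← Nat.cast_le (α := ℕ∞), hcoe, gap, le_iInf₂_iff]
  simp only [Nat.cast_le, Set.mem_ofPred_eq]
  constructor
  · intro h i hi hik
    by_contra! hc
    have := h i ⟨hi, hc⟩
    omega
  · intro h i hi
    by_contra! hc
    have := h i hi.1 (by omega)
    omega

/-- The multiset `1, 1, 2, 2, …, k - 1, k - 1, k`. -/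
def squareStair (k : ℕ) : Multiset ℕ := (Finset.Icc 1 k).val + (Finset.Ico 1 k).val

theorem count_squareStair (k i : ℕ) :
    (squareStair k).count i =
      (if 1 ≤ i ∧ i ≤ k then 1 else 0) + (if 1 ≤ i ∧ i < k then 1 else 0) := by
  rw [squareStair, Multiset.count_add, Multiset.count_eq_of_nodup (Finset.nodup _),
    Multiset.count_eq_of_nodup (Finset.nodup _)]
  simp

theorem sum_squareStair (k : ℕ) : (squareStair k).sum = k ^ 2 := by
  have h : (squareStair k).sum = ∑ i ∈ Finset.Icc 1 k, i + ∑ i ∈ Finset.Ico 1 k, i := by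
    simp [squareStair]
  rw [h]
  clear h
  induction k with
  | zero => simp
  | succ k ih =>
    rw [Finset.sum_Icc_succ_top (by omega)]
    rcases Nat.eq_zero_or_pos k with rfl | hk
    · simp
    · rw [Finset.sum_Ico_succ_top hk]
      nlinarith

/-- The parts below `k` are needed twice, which bounds the 2-gap; `k` itself is needed only once,
which bounds the 1-gap. -/
theorem squareStair_le_iff {n : ℕ} (l : Nat.Partition n) (k : ℕ) :
    squareStair k ≤ l.parts ↔ k ≤ (gap 2 l).toNat ∧ k < (gap 1 l).toNat := by
  rw [lt_toNat_gap_iff le_rfl, Multiset.le_iff_count]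
  simp only [count_squareStair]
  constructor
  · intro h
    constructor
    · rcases k with _ | k
      · exact Nat.zero_le _
      · refine (lt_toNat_gap_iff one_le_two l k).mpr fun i hi hik => ?_
        have := h i
        rw [if_pos (by omega), if_pos (by omega)] at this
        exact this
    · intro i hi hik
      have := h i
      rw [if_pos (by omega)] at this
      omega
  · rintro ⟨h1, h2⟩ i
    by_cases hi : 1 ≤ i ∧ i < k
    · rw [if_pos (by omega), if_pos hi]
      exact (lt_toNat_gap_iff one_le_two l (k - 1)).mp (by omega) i (by omega) (by omega)
    · rw [if_neg hi]
      split_ifs with h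
      · exact h2 i (by omega) h.2
      · omega

theorem le_of_squareStair_le {n : ℕ} {l : Nat.Partition n} {k : ℕ} (h : squareStair k ≤ l.parts) :
    k ≤ n := by
  have hsum : (squareStair k).sum ≤ l.parts.sum := by
    obtain ⟨u, hu⟩ := Multiset.le_iff_exists_add.mp h
    rw [hu, Multiset.sum_add]
    omega
  rw [sum_squareStair, l.parts_sum] at hsum
  nlinarith

theorem pos_of_mem_squareStair {k i : ℕ} (h : i ∈ squareStair k) : 0 < i := by
  simp only [squareStair, Multiset.mem_add, Finset.mem_val, Finset.mem_Icc, Finset.mem_Ico] at h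
  omega

/-- Partitions of `n` containing a multiset of sum `m` correspond to partitions of `n - m`. -/
theorem card_filter_le_parts {n : ℕ} {u : Multiset ℕ} (hu : ∀ i ∈ u, 0 < i) :
    (Finset.univ.filter fun l : Nat.Partition n => u ≤ l.parts).card = p ((n : ℤ) - u.sum) := by
  rw [p]
  split_ifs with h
  · have hle : u.sum ≤ n := by omega
    rw [← Fintype.card_subtype]
    refine Fintype.card_congr
      { toFun := fun l => ⟨l.1.parts - u, fun {i} hi => l.1.parts_pos (Multiset.mem_of_le
          (Multiset.sub_le_self _ _) hi), ?_⟩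
        invFun := fun l => ⟨⟨l.parts + u, fun {i} hi => ?_, ?_⟩, Multiset.le_add_left _ _⟩
        left_inv := fun l => ?_
        right_inv := fun l => ?_ }
    · have h1 := congrArg Multiset.sum (tsub_add_cancel_of_le l.2)
      rw [Multiset.sum_add, l.1.parts_sum] at h1
      omega
    · rcases Multiset.mem_add.mp hi with hi | hi
      · exact l.parts_pos hi
      · exact hu i hi
    · rw [Multiset.sum_add, l.parts_sum]
      omega
    · exact Subtype.ext (Nat.Partition.ext (tsub_add_cancel_of_le l.2))
    · exact Nat.Partition.ext (add_tsub_cancel_right _ _)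
  · rw [Finset.card_eq_zero, Finset.filter_eq_empty_iff]
    intro l _ hl
    obtain ⟨v, hv⟩ := Multiset.le_iff_exists_add.mp hl
    have h1 := l.parts_sum
    rw [hv, Multiset.sum_add] at h1
    omega

/-- The admissible `k` are those below the 2-gap, and also the 2-gap itself exactly when it is
smaller than the 1-gap. -/
theorem card_squareStair_le {n : ℕ} (l : Nat.Partition n) :
    ((Finset.range (n + 1)).filter fun k => squareStair k ≤ l.parts).card =
      (gap 2 l).toNat + if gap 2 l < gap 1 l then 1 else 0 := by
  have hlt : gap 2 l < gap 1 l ↔ (gap 2 l).toNat < (gap 1 l).toNat := by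
    rw [← Nat.cast_lt (α := ℕ∞), ENat.natCast_toNat (gap_ne_top one_le_two l),
      ENat.natCast_toNat (gap_ne_top le_rfl l)]
  have hle : (gap 2 l).toNat ≤ (gap 1 l).toNat := by
    by_contra! hc
    have h2 := (lt_toNat_gap_iff one_le_two l _).mp hc
    exact lt_irrefl _ ((lt_toNat_gap_iff le_rfl l (gap 1 l).toNat).mpr fun i hi hik =>
      one_le_two.trans (h2 i hi hik))
  have hset : ((Finset.range (n + 1)).filter fun k => squareStair k ≤ l.parts) =
      Finset.range ((gap 2 l).toNat + if gap 2 l < gap 1 l then 1 else 0) := by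
    ext k
    rw [Finset.mem_filter, Finset.mem_range, Finset.mem_range]
    refine ⟨fun h => ?_, fun h => ?_⟩
    · have := (squareStair_le_iff l k).mp h.2
      split_ifs with hg
      · omega
      · rw [hlt] at hg
        omega
    · have hk : squareStair k ≤ l.parts := by
        rw [squareStair_le_iff]
        split_ifs at h with hg
        · rw [hlt] at hg
          omega
        · omega
      exact ⟨Nat.lt_succ_iff.mpr (le_of_squareStair_le hk), hk⟩
  rw [hset, Finset.card_range]

/-- Double counting: fixing the partition gives the left side; fixing `k` and removing the staircase
gives the right side. -/
theorem S_add_G_eq_sum (n : ℕ) :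
    S 2 n + G 2 n = ∑ k ∈ Finset.range (n + 1), p ((n : ℤ) - (k : ℤ) ^ 2) := by
  classical
  have hG : G 2 n = ∑ l : Nat.Partition n, if gap 2 l < gap 1 l then 1 else 0 := by
    rw [G, Nat.card_eq_fintype_card, Fintype.card_subtype, Finset.card_filter]
  rw [S, hG, ← Finset.sum_add_distrib]
  simp_rw [← card_squareStair_le, Finset.card_filter]
  rw [Finset.sum_comm]
  refine Finset.sum_congr rfl fun k _ => ?_
  rw [← Finset.card_filter, card_filter_le_parts fun i hi => pos_of_mem_squareStair hi,
    sum_squareStair, Nat.cast_pow]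

theorem hasSum_p_sub_sq (n : ℕ) :
    HasSum (fun k : ℕ => (p ((n : ℤ) - (k : ℤ) ^ 2) : ℚ)) (S 2 n + G 2 n) := by
  have h := S_add_G_eq_sum n
  have h' : (S 2 n + G 2 n : ℚ) =
      ∑ k ∈ Finset.range (n + 1), (p ((n : ℤ) - (k : ℤ) ^ 2) : ℚ) := by
    exact_mod_cast h
  rw [h']
  refine hasSum_sum_of_ne_finset_zero fun k hk => ?_
  rw [Finset.mem_range, not_lt] at hk
  rw [p, if_neg, Nat.cast_zero]
  have : (n : ℤ) + 1 ≤ k := by exact_mod_cast hk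
  nlinarith

/-- Half the sum of the plain and alternating series vanishes at odd `k`, half the difference at
even `k`, so each can be reindexed along an injection. -/
theorem hasSum_p_sub_even_odd_sq {n : ℕ} {e : ℚ}
    (he : HasSum (fun k : ℕ => (-1 : ℚ) ^ k * p ((n : ℤ) - (k : ℤ) ^ 2)) e) :
    HasSum (fun k : ℕ => (p ((n : ℤ) - (2 * (k : ℤ)) ^ 2) : ℚ)) ((S 2 n + G 2 n + e) / 2) ∧
    HasSum (fun k : ℕ => (p ((n : ℤ) - (2 * (k : ℤ) + 1) ^ 2) : ℚ)) ((S 2 n + G 2 n - e) / 2) := by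
  have ha := ((hasSum_p_sub_sq n).add he).div_const 2
  have hb := ((hasSum_p_sub_sq n).sub he).div_const 2
  constructor
  · have hinj : Function.Injective fun k : ℕ => 2 * k := fun a b h => by simpa using h
    rw [← hinj.hasSum_iff] at ha
    · convert! ha using 2 with k
      simp [pow_mul]
    · intro k hk
      have : Odd k := Nat.not_even_iff_odd.mp fun ⟨m, hm⟩ => hk ⟨m, by simp only; omega⟩
      simp [this.neg_one_pow]
  · have hinj : Function.Injective fun k : ℕ => 2 * k + 1 := fun a b h => by simpa using h
    rw [← hinj.hasSum_iff] at hb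
    · convert! hb using 2 with k
      simp [pow_mul, pow_succ]
    · intro k hk
      have : Even k := Nat.not_odd_iff_even.mp fun ⟨m, hm⟩ => hk ⟨m, hm.symm⟩
      simp [this.neg_one_pow]

end LeastGap

theorem mainTheorem9 (n : ℕ) :
    HasSum (fun k : ℕ => (LeastGap.p ((n : ℤ) - (2 * (k : ℤ)) ^ 2) : ℚ))
      (((LeastGap.S 2 n : ℚ) + (LeastGap.G 2 n : ℚ) + (LeastGap.pEven n : ℚ)) / 2) ∧
    HasSum (fun k : ℕ => (LeastGap.p ((n : ℤ) - (2 * (k : ℤ) + 1) ^ 2) : ℚ))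
      (((LeastGap.S 2 n : ℚ) + (LeastGap.G 2 n : ℚ) - (LeastGap.pEven n : ℚ)) / 2) :=
  LeastGap.hasSum_p_sub_even_odd_sq (LeastGap.hasSum_neg_one_pow_mul_p n)
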